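/- Consider the Bell scenario with two parties, two settings $x,y\in\{0,1\}$ and two outcomes $a,b\in\{0,1\}$ each. Let $\mathcal Q_{\mathrm{finite}}\subset\mathbb R^{16}$ be the set of all behaviours of the form $P(ab|xy)=\operatorname{tr}[(E_a^x\otimes F_b^y)\rho]$, where $\rho$ is a density matrix on $\mathbb C^d\otimes\mathbb C^d$ for some finite $d$, and for all $x,y$ the families $\{E_a^x\}_a$ and $\{F_b^y\}_b$ consist of positive semidefinite $d\times d$ matrices that sum to the identity. Let $\mathcal Q$ be the closure of $\mathcal Q_{\mathrm{finite}}$. Write $\langle A_x\rangle=P(a=0|x)-P(a=1|x)$, $\langle B_y\rangle=P(b=0|y)-P(b=1|y)$ and $\langle A_xB_y\rangle=P(a=b|xy)-P(a\neq b|xy)$. Consider the two-dimensional slice given by $\langle A_x\rangle=\langle B_y\rangle=0$ for all $x,y$ and $\langle A_0B_0\rangle=\langle A_0B_1\rangle=\langle A_1B_0\rangle=:\alpha$. Every point of $\mathcal Q$ in this slice has $-1\le\alpha\le1$, and for each $\alpha\in[-1,1]$ the maximum of $-\langle A_1B_1\rangle$ over the points of $\mathcal Q$ in the slice with this value of $\alpha$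 is $$f(\alpha)=\begin{cases}1, & -1\le\alpha<\tfrac12,\\ 3\alpha-4\alpha^3, & \tfrac12\le\alpha\le1.\end{cases}$$ The flat and the curved part of this boundary meet at $\alpha=\tfrac12$ with equal slope: both one-sided derivatives of $f$ at $\tfrac12$ (with value $f(\tfrac12)=1$) are $0$. Let $P_{\mathrm{NE}}$ be the corresponding boundary point, i.e. the behaviour $P_{\mathrm{NE}}(ab|xy)=\tfrac14\big(1+(-1)^{a+b}\langle A_xB_y\rangle\big)$ with zero marginals, $\langle A_0B_0\rangle=\langle A_0B_1\rangle=\langle A_1B_0\rangle=\tfrac12$ and $\langle A_1B_1\rangle=-1$. Then $P_{\mathrm{NE}}$ is an extremal point of $\mathcal Q$, but it is not an exposed point of $\mathcal Q$ (that is, it is not the unique maximiser over $\mathcal Q$ of any linear functional); it is not even exposed in the intersection of $\mathcal Q$ with the slice. -/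

import Mathlib

open scoped ComplexOrder

/-- A behaviour in the bipartite scenario with `m` settings and `Δ` outcomes per party:
`P x y a b` is the number `P(ab|xy)`. -/
abbrev Behaviour (m Δ : ℕ) : Type := Fin m → Fin m → Fin Δ → Fin Δ → ℝ

/-- A quantum state: a positive semidefinite matrix of unit trace. -/
def IsState {ι : Type*} [Fintype ι] (ρ : Matrix ι ι ℂ) : Prop :=
  ρ.PosSemidef ∧ ρ.trace = 1

/-- A local measurement with `Δ` outcomes on a `d`-dimensional system: positive semidefinite
matrices that sum to the identity. -/
def IsMeasurement {d Δ : ℕ} (E : Fin Δ → Matrix (Fin d) (Fin d) ℂ) : Prop :=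
  (∀ a, (E a).PosSemidef) ∧ ∑ a, E a = 1

/-- The behaviours which can be generated with local Hilbert spaces of finite dimension `d`. -/
def quantumFinite (m Δ : ℕ) : Set (Behaviour m Δ) :=
  {P | ∃ (d : ℕ) (ρ : Matrix (Fin d × Fin d) (Fin d × Fin d) ℂ)
      (E F : Fin m → Fin Δ → Matrix (Fin d) (Fin d) ℂ),
      IsState ρ ∧ (∀ x, IsMeasurement (E x)) ∧ (∀ y, IsMeasurement (F y)) ∧
      ∀ x y a b, (P x y a b : ℂ) = (Matrix.kronecker (E x a) (F y b) * ρ).trace}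

/-- The quantum set: the closure of the set of finite-dimensional quantum behaviours. -/
def quantumSet (m Δ : ℕ) : Set (Behaviour m Δ) := closure (quantumFinite m Δ)

/-- Alice's marginal `⟨A_x⟩ = P(a = 0 | x) - P(a = 1 | x)`, computed from the distribution for
the settings `x, y`. For a no-signalling point it does not depend on `y`. -/
def margA (P : Behaviour 2 2) (x y : Fin 2) : ℝ := ∑ b, P x y 0 b - ∑ b, P x y 1 b

/-- Bob's marginal `⟨B_y⟩ = P(b = 0 | y) - P(b = 1 | y)`, computed from the distribution for
the settings `x, y`. For a no-signalling point it does not depend on `x`. -/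
def margB (P : Behaviour 2 2) (x y : Fin 2) : ℝ := ∑ a, P x y a 0 - ∑ a, P x y a 1

/-- The correlator `⟨A_x B_y⟩ = P(a = b | x y) - P(a ≠ b | x y)`. -/
def corr (P : Behaviour 2 2) (x y : Fin 2) : ℝ :=
  ∑ a, ∑ b, if a = b then P x y a b else -P x y a b

/-- Unbiased marginals and `⟨A_0 B_0⟩ = ⟨A_0 B_1⟩ = ⟨A_1 B_0⟩ = α`. -/
def InSlice (α : ℝ) (P : Behaviour 2 2) : Prop :=
  (∀ x y, margA P x y = 0) ∧ (∀ x y, margB P x y = 0) ∧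
    corr P 0 0 = α ∧ corr P 0 1 = α ∧ corr P 1 0 = α

/-- The quantum points of the two-dimensional slice. -/
def quantumSlice : Set (Behaviour 2 2) := {P ∈ quantumSet 2 2 | ∃ α : ℝ, InSlice α P}

/-- The behaviour with marginals `A x`, `B y` and correlators `C x y`. -/
noncomputable def ofTable (A B : Fin 2 → ℝ) (C : Fin 2 → Fin 2 → ℝ) : Behaviour 2 2 :=
  fun x y a b => (1 / 4) * (1 + (-1) ^ (a : ℕ) * A x + (-1) ^ (b : ℕ) * B y +
    (-1) ^ ((a : ℕ) + (b : ℕ)) * C x y)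

/-- The point `P_NE`. -/
noncomputable def pointNE : Behaviour 2 2 :=
  ofTable (fun _ => 0) (fun _ => 0) ![![1 / 2, 1 / 2], ![1 / 2, -1]]

/-- The flat part followed by the curved part. -/
noncomputable def sliceBound (α : ℝ) : ℝ := if α < 1 / 2 then 1 else 3 * α - 4 * α ^ 3

/-! Correlators of a quantum model are inner products of the vectors `A x ψ` and `B y ψ`, whose
norms are at most one. Along the chain A₁, B₀, A₀, B₁ a sum of squares (`chained_inner_le`) yields
the bound 3α - 4α³, which equally spaced qubit directions attain; the flat part is the trivial bound
1, also attained by qubits.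

Extremality is lexicographic: P_NE is the only quantum point that maximises -⟨A₁B₁⟩ and then, on
that face, the sum of the other three correlators (`eq_pointNE`). Reaching both maxima forces A₁ψ =
-B₁ψ and A₀ψ = B₀ψ + B₁ψ, with A₀, B₀, B₁ squaring to the identity on ψ; then (B₀B₁ + B₁B₀)ψ = -ψ,
and all marginals vanish. To reach the closure without a model for its points, these relations are
proved with errors bounded by a continuous function of the behaviour, `defect`.

P_NE is not exposed because the boundary is differentiable there with horizontal tangent: a
functional maximal at P_NE cannot reward an increase of α, so the far end of the flat part does at
least as well. -/

open scoped RealInnerProductSpace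

/-- Symmetric contractions `A x`, `B y` of a real semi-inner product space, such that each `A x`
commutes with each `B y`, together with a unit vector. -/
structure CorrelationModel (H : Type*) [SeminormedAddCommGroup H] [InnerProductSpace ℝ H] where
  A : Fin 2 → H →ₗ[ℝ] H
  B : Fin 2 → H →ₗ[ℝ] H
  ψ : H
  norm_ψ : ‖ψ‖ = 1
  symm_A : ∀ x, (A x).IsSymmetric
  symm_B : ∀ y, (B y).IsSymmetric
  norm_A_le : ∀ x v, ‖A x v‖ ≤ ‖v‖
  norm_B_le : ∀ y v, ‖B y v‖ ≤ ‖v‖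
  comm : ∀ x y v, A x (B y v) = B y (A x v)

/-! ### Inequalities for vectors and symmetric contractions -/

section Vectors

variable {H : Type*} [SeminormedAddCommGroup H] [InnerProductSpace ℝ H]

/-- Unit vectors in a plane at successive angles θ satisfy wᵢ₋₁ + wᵢ₊₁ = 2 cos θ • wᵢ, so for s = 2
cos θ both residuals X, Y vanish and equality holds. In general the gap is |X + Y|²/2 + (s - 1)(|X|²
+ |Y|²)/2 plus nonnegative multiples of 1 - |wᵢ|². -/
theorem chained_inner_le {w₀ w₁ w₂ w₃ : H} (h₀ : ‖w₀‖ ≤ 1) (h₁ : ‖w₁‖ ≤ 1) (h₂ : ‖w₂‖ ≤ 1)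
    (h₃ : ‖w₃‖ ≤ 1) {s : ℝ} (hs : 1 ≤ s) :
    (s ^ 2 - 1) * (⟪w₀, w₁⟫ + ⟪w₁, w₂⟫ + ⟪w₂, w₃⟫) - ⟪w₀, w₃⟫ ≤ s ^ 3 := by
  have key (w : H) (h : ‖w‖ ≤ 1) : ⟪w, w⟫ ≤ 1 := by
    rw [real_inner_self_eq_norm_sq]; exact pow_le_one₀ (norm_nonneg _) h
  have hX : 0 ≤ ⟪w₀ + w₂ - s • w₁, w₀ + w₂ - s • w₁⟫ := real_inner_self_nonneg
  have hY : 0 ≤ ⟪w₁ + w₃ - s • w₂, w₁ + w₃ - s • w₂⟫ := real_inner_self_nonneg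
  have hZ : 0 ≤ ⟪(w₀ + w₂ - s • w₁) + (w₁ + w₃ - s • w₂),
    (w₀ + w₂ - s • w₁) + (w₁ + w₃ - s • w₂)⟫ := real_inner_self_nonneg
  simp only [inner_add_left, inner_add_right, inner_sub_left, inner_sub_right,
    real_inner_smul_left, real_inner_smul_right] at hX hY hZ
  rw [real_inner_comm w₀ w₁, real_inner_comm w₀ w₂, real_inner_comm w₁ w₂] at hX
  rw [real_inner_comm w₁ w₂, real_inner_comm w₁ w₃, real_inner_comm w₂ w₃] at hY
  rw [real_inner_comm w₀ w₁, real_inner_comm w₀ w₂, real_inner_comm w₀ w₃,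
    real_inner_comm w₁ w₂, real_inner_comm w₁ w₃, real_inner_comm w₂ w₃] at hZ
  have k₀ := mul_le_mul_of_nonneg_left (key w₀ h₀) (by linarith : 0 ≤ s / 2)
  have k₃ := mul_le_mul_of_nonneg_left (key w₃ h₃) (by linarith : 0 ≤ s / 2)
  have hs' : 0 ≤ (s ^ 3 - s) / 2 := by
    have : 0 ≤ s * (s - 1) * (s + 1) := by
      have := sub_nonneg.2 hs
      positivity
    nlinarith
  have k₁ := mul_le_mul_of_nonneg_left (key w₁ h₁) hs'
  have k₂ := mul_le_mul_of_nonneg_left (key w₂ h₂) hs'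
  have hX' := mul_nonneg (by linarith : 0 ≤ (s - 1) / 2) hX
  have hY' := mul_nonneg (by linarith : 0 ≤ (s - 1) / 2) hY
  linarith

/-- Expanding the square produces ⟪v, e⟫, which is not a correlator when `v`, `e` both belong to
Bob; it is traded for -⟪w, v⟫ at a cost of `‖w + e‖`. Keeping the defects on the left lets one bound
control all of them. -/
theorem two_mul_inner_add_le {u v e w : H} (hv : ‖v‖ ≤ 1)
    (p q r : ℝ) :
    p ^ 2 * (1 - ‖u‖ ^ 2) + q ^ 2 * (1 - ‖v‖ ^ 2) + r ^ 2 * (1 - ‖e‖ ^ 2) +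
      ‖p • u - q • v - r • e‖ ^ 2 + 2 * p * q * ⟪u, v⟫ + 2 * p * r * ⟪u, e⟫ + 2 * q * r * ⟪w, v⟫ ≤
    p ^ 2 + q ^ 2 + r ^ 2 + 2 * |q * r| * ‖w + e‖ := by
  have h : ⟪v, w + e⟫ ≤ ‖w + e‖ := (real_inner_le_norm _ _).trans
    (mul_le_of_le_one_left (norm_nonneg _) hv)
  have h' : -‖w + e‖ ≤ ⟪v, w + e⟫ := neg_le_of_neg_le ((neg_le_abs _).trans
    ((abs_real_inner_le_norm _ _).trans (mul_le_of_le_one_left (norm_nonneg _) hv)))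
  have h2 : q * r * ⟪v, w + e⟫ ≤ |q * r| * ‖w + e‖ := by
    refine (le_abs_self _).trans ?_
    rw [abs_mul]
    exact mul_le_mul_of_nonneg_left (abs_le.2 ⟨h', h⟩) (abs_nonneg _)
  rw [← real_inner_self_eq_norm_sq (p • u - q • v - r • e), ← real_inner_self_eq_norm_sq u,
    ← real_inner_self_eq_norm_sq v, ← real_inner_self_eq_norm_sq e]
  simp only [inner_add_right, inner_sub_left, inner_sub_right,
    real_inner_smul_left, real_inner_smul_right] at h2 ⊢
  rw [real_inner_comm v u, real_inner_comm e u, real_inner_comm e v, real_inner_comm v w] at *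
  linarith

theorem norm_apply_apply_sub_sq_le {A : H →ₗ[ℝ] H} (hA : A.IsSymmetric)
    (hn : ∀ v, ‖A v‖ ≤ ‖v‖) (v : H) : ‖A (A v) - v‖ ^ 2 ≤ ‖v‖ ^ 2 - ‖A v‖ ^ 2 := by
  have h : ⟪A (A v), v⟫ = ‖A v‖ ^ 2 := by rw [hA, real_inner_self_eq_norm_sq]
  have h2 : ‖A (A v)‖ ^ 2 ≤ ‖A v‖ ^ 2 := pow_le_pow_left₀ (norm_nonneg _) (hn _) 2
  rw [norm_sub_sq_real, h]
  linarith

/-- An approximate trace property: if `A`, commuting with `B` and `C`, acts on `v` almost like `B`,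
then conjugation by `B` almost preserves the expectation of `C`. -/
theorem abs_inner_conj_sub_le {A B C : H →ₗ[ℝ] H} (hA : A.IsSymmetric)
    (hC : C.IsSymmetric) (hBn : ∀ v, ‖B v‖ ≤ ‖v‖) (hCn : ∀ v, ‖C v‖ ≤ ‖v‖)
    (hAB : ∀ v, A (B v) = B (A v)) (hAC : ∀ v, A (C v) = C (A v)) {v : H} (hv : ‖v‖ = 1)
    {κ η : ℝ} (hκ : ‖A v - B v‖ ≤ κ) (hη : ‖B (B v) - v‖ ≤ η) :
    |⟪B v, C (B v)⟫ - ⟪v, C v⟫| ≤ 2 * κ + η := by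
  have e : ⟪B v, C (B v)⟫ - ⟪v, C v⟫ =
      -⟪C (B v), A v - B v⟫ + ⟪B (A v - B v), C v⟫ + ⟪B (B v) - v, C v⟫ := by
    have h1 : ⟪C (B v), A v⟫ = ⟪B (A v), C v⟫ := by
      rw [hC (B v) (A v), ← hAC, ← hA (B v) (C v), hAB]
    simp only [map_sub, inner_sub_left, inner_sub_right]
    rw [h1, hC (B v) (B v)]
    ring
  have b1 : |⟪C (B v), A v - B v⟫| ≤ κ := by
    refine (abs_real_inner_le_norm _ _).trans ?_
    refine (mul_le_of_le_one_left (norm_nonneg _) ?_).trans hκ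
    exact (hCn _).trans ((hBn _).trans hv.le)
  have b2 : |⟪B (A v - B v), C v⟫| ≤ κ := by
    refine (abs_real_inner_le_norm _ _).trans ?_
    exact (mul_le_of_le_one_right (norm_nonneg _) ((hCn _).trans hv.le)).trans ((hBn _).trans hκ)
  have b3 : |⟪B (B v) - v, C v⟫| ≤ η := by
    refine (abs_real_inner_le_norm _ _).trans ?_
    exact (mul_le_of_le_one_right (norm_nonneg _) ((hCn _).trans hv.le)).trans hη
  rw [e, abs_le]
  rw [abs_le] at b1 b2 b3
  constructor <;> linarith

end Vectors

/-! ### Approximate operator relations near the maximum -/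

namespace CorrelationModel

variable {H : Type*} [SeminormedAddCommGroup H] [InnerProductSpace ℝ H] (M : CorrelationModel H)

theorem norm_A_ψ_le (x : Fin 2) : ‖M.A x M.ψ‖ ≤ 1 := (M.norm_A_le x _).trans M.norm_ψ.le

theorem norm_B_ψ_le (y : Fin 2) : ‖M.B y M.ψ‖ ≤ 1 := (M.norm_B_le y _).trans M.norm_ψ.le

theorem abs_inner_le_one (x y : Fin 2) : |⟪M.A x M.ψ, M.B y M.ψ⟫| ≤ 1 :=
  (abs_real_inner_le_norm _ _).trans
    (mul_le_one₀ (M.norm_A_ψ_le x) (norm_nonneg _) (M.norm_B_ψ_le y))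

theorem norm_A_one_add_B_one_sq_le :
    ‖M.A 1 M.ψ + M.B 1 M.ψ‖ ^ 2 ≤ 2 + 2 * ⟪M.A 1 M.ψ, M.B 1 M.ψ⟫ := by
  rw [norm_add_sq_real]
  have h1 := pow_le_one₀ (n := 2) (norm_nonneg _) (M.norm_A_ψ_le 1)
  have h2 := pow_le_one₀ (n := 2) (norm_nonneg _) (M.norm_B_ψ_le 1)
  linarith

/-- In the exact case ψ = A₀²ψ = (B₀ + B₁)²ψ = 2ψ + (B₀B₁ + B₁B₀)ψ, because A₀ commutes with both
B's. The six error terms are listed in `e`. -/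
theorem norm_anticommutator_le {η : ℝ} (h₀ : ‖M.A 0 M.ψ - M.B 0 M.ψ - M.B 1 M.ψ‖ ≤ η)
    (hA : ‖M.A 0 (M.A 0 M.ψ) - M.ψ‖ ≤ η) (hB : ∀ y, ‖M.B y (M.B y M.ψ) - M.ψ‖ ≤ η) :
    ‖M.ψ + M.B 0 (M.B 1 M.ψ) + M.B 1 (M.B 0 M.ψ)‖ ≤ 6 * η := by
  set r := M.A 0 M.ψ - M.B 0 M.ψ - M.B 1 M.ψ with hr
  have e : M.ψ + M.B 0 (M.B 1 M.ψ) + M.B 1 (M.B 0 M.ψ) =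
      (M.A 0 (M.A 0 M.ψ) - M.ψ) - M.A 0 r - M.B 0 r - M.B 1 r -
        (M.B 0 (M.B 0 M.ψ) - M.ψ) - (M.B 1 (M.B 1 M.ψ) - M.ψ) := by
    simp only [hr, map_sub, M.comm]
    abel
  rw [e]
  have n1 := (M.norm_A_le 0 r).trans h₀
  have n2 := (M.norm_B_le 0 r).trans h₀
  have n3 := (M.norm_B_le 1 r).trans h₀
  have := hB 0
  have := hB 1
  refine (norm_sub_le _ _).trans ?_
  refine (add_le_add_left (norm_sub_le _ _) _).trans ?_
  refine (add_le_add_left (add_le_add_left (norm_sub_le _ _) _) _).trans ?_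
  refine (add_le_add_left (add_le_add_left (add_le_add_left (norm_sub_le _ _) _) _) _).trans ?_
  refine (add_le_add_left (add_le_add_left (add_le_add_left (add_le_add_left
    (norm_sub_le _ _) _) _) _) _).trans ?_
  linarith

/-- Let b₀, b₁ be Bob's expectations. Pairing the anticommutation relation with B₀ψ and B₁ψ gives b₀
+ 2b₁ ≈ 0 and 2b₀ + b₁ ≈ 0, hence both are small. -/
theorem abs_expectation_B_le {η : ℝ} (h₀ : ‖M.A 0 M.ψ - M.B 0 M.ψ - M.B 1 M.ψ‖ ≤ η)
    (h₁ : ‖M.A 1 M.ψ + M.B 1 M.ψ‖ ≤ η)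
    (hA : ‖M.A 0 (M.A 0 M.ψ) - M.ψ‖ ≤ η) (hB : ∀ y, ‖M.B y (M.B y M.ψ) - M.ψ‖ ≤ η) (y : Fin 2) :
    |⟪M.ψ, M.B y M.ψ⟫| ≤ 12 * η := by
  have anti := M.norm_anticommutator_le h₀ hA hB
  have hη : 0 ≤ η := (norm_nonneg _).trans h₁
  have pair (y : Fin 2) :
      |⟪M.B y M.ψ, M.ψ + M.B 0 (M.B 1 M.ψ) + M.B 1 (M.B 0 M.ψ)⟫| ≤ 6 * η :=
    (abs_real_inner_le_norm _ _).trans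
      ((mul_le_of_le_one_left (norm_nonneg _) (M.norm_B_ψ_le y)).trans anti)
  have sq (y z : Fin 2) : |⟪M.B y M.ψ, M.B y (M.B z M.ψ)⟫ - ⟪M.ψ, M.B z M.ψ⟫| ≤ η := by
    rw [← M.symm_B y (M.B y M.ψ), ← inner_sub_left]
    exact (abs_real_inner_le_norm _ _).trans
      ((mul_le_of_le_one_right (norm_nonneg _) (M.norm_B_ψ_le z)).trans (hB y))
  have c1 := abs_inner_conj_sub_le (A := -M.A 1) (B := M.B 1) (C := M.B 0) (v := M.ψ)
    (κ := η) (η := η) (fun v w => by simp [M.symm_A 1 v w]) (M.symm_B 0) (M.norm_B_le 1)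
    (M.norm_B_le 0) (by simp [M.comm]) (by simp [M.comm]) M.norm_ψ
    (by rwa [LinearMap.neg_apply, ← norm_neg, neg_sub, sub_neg_eq_add, add_comm]) (hB 1)
  -- On ψ, A₀ + A₁ acts almost like B₀, since the two B₁ terms cancel. It need not be a contraction.
  have c0 := abs_inner_conj_sub_le (A := M.A 0 + M.A 1) (B := M.B 0) (C := M.B 1) (v := M.ψ)
    (κ := 2 * η) (η := η) ((M.symm_A 0).add (M.symm_A 1)) (M.symm_B 1) (M.norm_B_le 0)
    (M.norm_B_le 1) (by simp [M.comm]) (by simp [M.comm]) M.norm_ψ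
    (by
      have : (M.A 0 + M.A 1) M.ψ - M.B 0 M.ψ =
        (M.A 0 M.ψ - M.B 0 M.ψ - M.B 1 M.ψ) + (M.A 1 M.ψ + M.B 1 M.ψ) := by
        rw [LinearMap.add_apply]; abel
      rw [this, two_mul]
      exact (norm_add_le _ _).trans (add_le_add h₀ h₁)) (hB 0)
  have p0 := pair 0
  have p1 := pair 1
  have s0 := sq 0 1
  have s1 := sq 1 0
  simp only [inner_add_right] at p0 p1
  rw [real_inner_comm M.ψ (M.B 0 M.ψ)] at p0
  rw [real_inner_comm M.ψ (M.B 1 M.ψ)] at p1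
  rw [abs_le] at *
  fin_cases y
  · simp only [Fin.zero_eta]
    constructor <;> linarith
  · simp only [Fin.mk_one]
    constructor <;> linarith

theorem abs_expectation_A_le {η : ℝ} (h₀ : ‖M.A 0 M.ψ - M.B 0 M.ψ - M.B 1 M.ψ‖ ≤ η)
    (h₁ : ‖M.A 1 M.ψ + M.B 1 M.ψ‖ ≤ η)
    (hA : ‖M.A 0 (M.A 0 M.ψ) - M.ψ‖ ≤ η) (hB : ∀ y, ‖M.B y (M.B y M.ψ) - M.ψ‖ ≤ η) (x : Fin 2) :
    |⟪M.ψ, M.A x M.ψ⟫| ≤ 25 * η := by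
  have hη : 0 ≤ η := (norm_nonneg _).trans h₁
  have b0 := M.abs_expectation_B_le h₀ h₁ hA hB 0
  have b1 := M.abs_expectation_B_le h₀ h₁ hA hB 1
  have cs (w : H) (hw : ‖w‖ ≤ η) : |⟪M.ψ, w⟫| ≤ η :=
    (abs_real_inner_le_norm _ _).trans (by rwa [M.norm_ψ, one_mul])
  have r0 := cs _ h₀
  have r1 := cs _ h₁
  rw [inner_sub_right, inner_sub_right] at r0
  rw [inner_add_right] at r1
  rw [abs_le] at *
  fin_cases x
  · simp only [Fin.zero_eta]
    constructor <;> linarith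
  · simp only [Fin.mk_one]
    constructor <;> linarith

/-- The correlators bound how far a model is from the relations `A 1 ψ = -B 1 ψ`,
`A 0 ψ = B 0 ψ + B 1 ψ` and `A 0 (A 0 ψ) = ψ = B y (B y ψ)`. -/
theorem exists_defect_le {c₀ c₁ c₂ c₃ : ℝ} (h₀ : ⟪M.A 0 M.ψ, M.B 0 M.ψ⟫ = c₀)
    (h₁ : ⟪M.A 0 M.ψ, M.B 1 M.ψ⟫ = c₁) (h₂ : ⟪M.A 1 M.ψ, M.B 0 M.ψ⟫ = c₂)
    (h₃ : ⟪M.A 1 M.ψ, M.B 1 M.ψ⟫ = c₃) {η : ℝ}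
    (hη : η = √(2 + 2 * c₃) + √(3 - 2 * (c₀ + c₁ + c₂) + 2 * √(2 + 2 * c₃))) :
    ‖M.A 0 M.ψ - M.B 0 M.ψ - M.B 1 M.ψ‖ ≤ η ∧ ‖M.A 1 M.ψ + M.B 1 M.ψ‖ ≤ η ∧
      ‖M.A 0 (M.A 0 M.ψ) - M.ψ‖ ≤ η ∧ ∀ y, ‖M.B y (M.B y M.ψ) - M.ψ‖ ≤ η := by
  set e := √(2 + 2 * c₃)
  set g := 3 - 2 * (c₀ + c₁ + c₂) + 2 * e
  have he : 0 ≤ e := Real.sqrt_nonneg _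
  have hr1 : ‖M.A 1 M.ψ + M.B 1 M.ψ‖ ≤ e :=
    Real.le_sqrt_of_sq_le (h₃ ▸ M.norm_A_one_add_B_one_sq_le)
  -- With `w` = A₁ψ and `e` = B₁ψ, every squared defect is at most `g`, since the terms on the left
  -- are nonnegative.
  have main := two_mul_inner_add_le (u := M.A 0 M.ψ) (e := M.B 1 M.ψ) (w := M.A 1 M.ψ)
    (M.norm_B_ψ_le 0) 1 1 1
  simp only [one_smul, h₀, h₁, h₂] at main
  norm_num at main
  have n0 := pow_le_one₀ (n := 2) (norm_nonneg _) (M.norm_A_ψ_le 0)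
  have n1 := pow_le_one₀ (n := 2) (norm_nonneg _) (M.norm_B_ψ_le 0)
  have n2 := pow_le_one₀ (n := 2) (norm_nonneg _) (M.norm_B_ψ_le 1)
  have n3 := sq_nonneg ‖M.A 0 M.ψ - M.B 0 M.ψ - M.B 1 M.ψ‖
  have fin {t : ℝ} (ht : t ^ 2 ≤ g) : t ≤ η :=
    hη ▸ (Real.le_sqrt_of_sq_le ht).trans (le_add_of_nonneg_left he)
  have sqA := norm_apply_apply_sub_sq_le (M.symm_A 0) (M.norm_A_le 0) M.ψ
  have sqB0 := norm_apply_apply_sub_sq_le (M.symm_B 0) (M.norm_B_le 0) M.ψ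
  have sqB1 := norm_apply_apply_sub_sq_le (M.symm_B 1) (M.norm_B_le 1) M.ψ
  rw [M.norm_ψ, one_pow] at sqA sqB0 sqB1
  refine ⟨fin (by linarith), hη ▸ hr1.trans (le_add_of_nonneg_right (Real.sqrt_nonneg _)),
    fin (by linarith), fun y => fin ?_⟩
  fin_cases y
  · exact sqB0.trans (by linarith)
  · exact sqB1.trans (by linarith)

end CorrelationModel

/-! ### From states and measurements to correlation models -/

section MatrixForm

open Matrix

/-- The real semi-inner product `Re tr (y ρ xᴴ)` of a positive semidefinite matrix `ρ`. -/
@[reducible]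
noncomputable def stateCore {ι : Type*} [Fintype ι] {ρ : Matrix ι ι ℂ} (hρ : ρ.PosSemidef) :
    PreInnerProductSpace.Core ℝ (Matrix ι ι ℂ) where
  inner x y := ((y * ρ * xᴴ).trace).re
  conj_inner_symm x y := by
    rw [conj_trivial, ← Complex.conj_re, starRingEnd_apply, ← trace_conjTranspose]
    simp [conjTranspose_mul, hρ.isHermitian.eq, Matrix.mul_assoc]
  re_inner_nonneg x :=
    (Complex.nonneg_iff.mp (hρ.mul_mul_conjTranspose_same x).trace_nonneg).1
  add_left x y z := by simp [Matrix.mul_add]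
  smul_left x y r := by simp [conjTranspose_smul]

/-- The effects commute and sum to 1, so 1 - (E₀ - E₁)² = 4E₀E₁ = 4(E₀E₁E₀ + E₁E₀E₁). Projectivity
is not needed. -/
theorem posSemidef_one_sub_sq {d : ℕ} {E : Fin 2 → Matrix (Fin d) (Fin d) ℂ}
    (hE : IsMeasurement E) : (1 - (E 0 - E 1) * (E 0 - E 1)).PosSemidef := by
  obtain ⟨hp, hs⟩ := hE
  rw [Fin.sum_univ_two] at hs
  have h1 : E 1 = 1 - E 0 := eq_sub_of_add_eq' hs
  have h : (1 - (E 0 - E 1) * (E 0 - E 1)) =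
      (4 : ℝ) • (E 0 * E 1 * (E 0)ᴴ + E 1 * E 0 * (E 1)ᴴ) := by
    rw [(hp 0).isHermitian.eq, (hp 1).isHermitian.eq, h1]
    have : ∀ X : Matrix (Fin d) (Fin d) ℂ, (4 : ℝ) • X = 4 * X := fun X => by
      ext i j
      rw [show (4 : Matrix (Fin d) (Fin d) ℂ) * X = (4 : ℕ) • X by simp]
      simp
    rw [this]
    noncomm_ring
  rw [h]
  exact (((hp 1).mul_mul_conjTranspose_same _).add
    ((hp 0).mul_mul_conjTranspose_same _)).smul (by norm_num)

end MatrixForm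

/-- The marginals and correlators of `P` are those of a correlation model. -/
def IsModelled (P : Behaviour 2 2) : Prop :=
  ∃ (H : Type) (_ : SeminormedAddCommGroup H) (_ : InnerProductSpace ℝ H)
    (M : CorrelationModel H),
    (∀ x y, margA P x y = ⟪M.ψ, M.A x M.ψ⟫) ∧ (∀ x y, margB P x y = ⟪M.ψ, M.B y M.ψ⟫) ∧
      ∀ x y, corr P x y = ⟪M.A x M.ψ, M.B y M.ψ⟫

section

open Matrix

open scoped MatrixOrder Norms.L2Operator in
theorem exists_eq_conjTranspose_mul_self {ι : Type*} [Fintype ι] [DecidableEq ι] {X : Matrix ι ι ℂ}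
    (hX : X.PosSemidef) : ∃ B : Matrix ι ι ℂ, X = Bᴴ * B :=
  CStarAlgebra.nonneg_iff_eq_star_mul_self.mp hX.nonneg

theorem trace_re_conj_le {ι : Type*} [Fintype ι] [DecidableEq ι] {ρ X : Matrix ι ι ℂ}
    (hρ : ρ.PosSemidef) (hX : (1 - X * X).PosSemidef) (v : Matrix ι ι ℂ) :
    ((X * v * ρ * (vᴴ * X)).trace).re ≤ ((v * ρ * vᴴ).trace).re := by
  obtain ⟨B, hB⟩ := exists_eq_conjTranspose_mul_self hX
  have h := (Complex.nonneg_iff.mp (hρ.mul_mul_conjTranspose_same (B * v)).trace_nonneg).1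
  have e : (B * v * ρ * (B * v)ᴴ).trace = (v * ρ * vᴴ).trace - (X * v * ρ * (vᴴ * X)).trace := by
    have e1 : (B * v * ρ * (B * v)ᴴ).trace = (v * ρ * vᴴ * (Bᴴ * B)).trace := by
      rw [conjTranspose_mul, Matrix.mul_assoc B v, Matrix.mul_assoc B, Matrix.trace_mul_comm]
      simp only [Matrix.mul_assoc]
    have e2 : (X * v * ρ * (vᴴ * X)).trace = (v * ρ * vᴴ * (X * X)).trace := by
      rw [Matrix.mul_assoc X v, Matrix.mul_assoc X, Matrix.trace_mul_comm]
      simp only [Matrix.mul_assoc]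
    rw [e1, e2, ← hB, Matrix.mul_sub, Matrix.mul_one, Matrix.trace_sub]
  rw [e, Complex.sub_re] at h
  linarith

variable {ι : Type} [Fintype ι] [DecidableEq ι]

/-- This is the GNS construction: observables act by left multiplication on matrices and ψ is the
identity matrix. A seminorm suffices, so null vectors are not quotiented out. -/
theorem exists_correlationModel {ρ : Matrix ι ι ℂ} (hρ : IsState ρ) {X Y : Fin 2 → Matrix ι ι ℂ}
    (hX : ∀ x, (X x).IsHermitian) (hY : ∀ y, (Y y).IsHermitian)
    (hX1 : ∀ x, (1 - X x * X x).PosSemidef) (hY1 : ∀ y, (1 - Y y * Y y).PosSemidef)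
    (hXY : ∀ x y, X x * Y y = Y y * X x) :
    ∃ (H : Type) (_ : SeminormedAddCommGroup H) (_ : InnerProductSpace ℝ H)
      (M : CorrelationModel H), (∀ x, ⟪M.ψ, M.A x M.ψ⟫ = ((X x * ρ).trace).re) ∧
        (∀ y, ⟪M.ψ, M.B y M.ψ⟫ = ((Y y * ρ).trace).re) ∧
        ∀ x y, ⟪M.A x M.ψ, M.B y M.ψ⟫ = ((X x * Y y * ρ).trace).re := by
  let c : PreInnerProductSpace.Core ℝ (Matrix ι ι ℂ) := stateCore hρ.1
  let n : SeminormedAddCommGroup (Matrix ι ι ℂ) :=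
    @InnerProductSpace.Core.toSeminormedAddCommGroup ℝ _ _ _ _ c
  let i : InnerProductSpace ℝ (Matrix ι ι ℂ) := InnerProductSpace.ofCore c
  have hi (v w : Matrix ι ι ℂ) : ⟪v, w⟫ = ((w * ρ * vᴴ).trace).re := rfl
  have symm {Z : Matrix ι ι ℂ} (hZ : Z.IsHermitian) :
      (LinearMap.mulLeft ℝ Z).IsSymmetric := fun v w => by
    rw [hi, hi, LinearMap.mulLeft_apply, LinearMap.mulLeft_apply, conjTranspose_mul, hZ.eq,
      Matrix.mul_assoc Z w, Matrix.mul_assoc Z, Matrix.trace_mul_comm Z]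
    simp only [Matrix.mul_assoc]
  have contr {Z : Matrix ι ι ℂ} (hZ : Z.IsHermitian) (hZ1 : (1 - Z * Z).PosSemidef)
      (v : Matrix ι ι ℂ) : ‖LinearMap.mulLeft ℝ Z v‖ ≤ ‖v‖ := by
    refine le_of_sq_le_sq ?_ (norm_nonneg _)
    rw [← real_inner_self_eq_norm_sq, ← real_inner_self_eq_norm_sq, hi, hi,
      LinearMap.mulLeft_apply, conjTranspose_mul, hZ.eq]
    exact trace_re_conj_le hρ.1 hZ1 v
  refine ⟨Matrix ι ι ℂ, n, i, ⟨fun x => LinearMap.mulLeft ℝ (X x), fun y => LinearMap.mulLeft ℝ (Y y),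
    1, ?_, fun x => symm (hX x), fun y => symm (hY y), fun x => contr (hX x) (hX1 x),
    fun y => contr (hY y) (hY1 y), fun x y v => ?_⟩, fun x => ?_, fun y => ?_, fun x y => ?_⟩
  · have h : ‖(1 : Matrix ι ι ℂ)‖ ^ 2 = 1 := by
      rw [← real_inner_self_eq_norm_sq, hi]
      simp [hρ.2]
    exact (pow_eq_one_iff_of_nonneg (norm_nonneg _) two_ne_zero).1 h
  · simp only [LinearMap.mulLeft_apply, ← mul_assoc, hXY]
  · simp [hi]
  · simp [hi]
  · simp only [hi, LinearMap.mulLeft_apply, Matrix.mul_one, (hX x).eq]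
    rw [Matrix.trace_mul_comm, ← Matrix.mul_assoc]

end

section Finite

open Matrix

theorem sub_kronecker_eq {m n : ℕ} (X Y : Matrix (Fin m) (Fin m) ℂ) (Z : Matrix (Fin n) (Fin n) ℂ) :
    kronecker (X - Y) Z = kronecker X Z - kronecker Y Z := by
  ext
  simp [sub_mul]

theorem kronecker_sub_eq {m n : ℕ} (X : Matrix (Fin m) (Fin m) ℂ) (Y Z : Matrix (Fin n) (Fin n) ℂ) :
    kronecker X (Y - Z) = kronecker X Y - kronecker X Z := by
  ext
  simp [mul_sub]

theorem IsMeasurement.isHermitian_sub {d : ℕ} {E : Fin 2 → Matrix (Fin d) (Fin d) ℂ}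
    (hE : IsMeasurement E) : (E 0 - E 1).IsHermitian :=
  (hE.1 0).isHermitian.sub (hE.1 1).isHermitian

theorem isModelled_of_mem_quantumFinite {P : Behaviour 2 2} (hP : P ∈ quantumFinite 2 2) :
    IsModelled P ∧ ∀ x y, ∑ a, ∑ b, P x y a b = 1 := by
  obtain ⟨d, ρ, E, F, hρ, hE, hF, hP⟩ := hP
  have re (x y a b) : P x y a b = ((Matrix.kronecker (E x a) (F y b) * ρ).trace).re := by
    rw [← hP, Complex.ofReal_re]
  have sE (x) : E x 0 + E x 1 = 1 := by rw [← Fin.sum_univ_two]; exact (hE x).2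
  have sF (y) : F y 0 + F y 1 = 1 := by rw [← Fin.sum_univ_two]; exact (hF y).2
  have h1 : (1 : Matrix (Fin d × Fin d) (Fin d × Fin d) ℂ) = kronecker 1 1 :=
    one_kronecker_one.symm
  obtain ⟨H, i₁, i₂, M, hA, hB, hC⟩ := exists_correlationModel hρ
    (X := fun x => kronecker (E x 0 - E x 1) 1) (Y := fun y => kronecker 1 (F y 0 - F y 1))
    (fun x => by
      rw [IsHermitian, kronecker, conjTranspose_kronecker, (hE x).isHermitian_sub.eq,
        conjTranspose_one])
    (fun y => by
      rw [IsHermitian, kronecker, conjTranspose_kronecker, (hF y).isHermitian_sub.eq,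
        conjTranspose_one])
    (fun x => by
      have : 1 - kronecker (E x 0 - E x 1) 1 * kronecker (E x 0 - E x 1) 1 =
          kronecker (1 - (E x 0 - E x 1) * (E x 0 - E x 1)) (1 : Matrix (Fin d) (Fin d) ℂ) := by
        rw [sub_kronecker_eq 1, h1, kronecker, ← mul_kronecker_mul, mul_one]
      rw [this]
      exact (posSemidef_one_sub_sq (hE x)).kronecker PosSemidef.one)
    (fun y => by
      have : 1 - kronecker 1 (F y 0 - F y 1) * kronecker 1 (F y 0 - F y 1) =
          kronecker (1 : Matrix (Fin d) (Fin d) ℂ) (1 - (F y 0 - F y 1) * (F y 0 - F y 1)) := by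
        rw [kronecker_sub_eq 1 1, h1, kronecker, ← mul_kronecker_mul, mul_one]
      rw [this]
      exact PosSemidef.one.kronecker (posSemidef_one_sub_sq (hF y)))
    (fun x y => by simp only [kronecker, ← mul_kronecker_mul, mul_one, one_mul])
  refine ⟨⟨H, i₁, i₂, M, fun x y => ?_, fun x y => ?_, fun x y => ?_⟩, fun x y => ?_⟩
  · rw [hA, ← sF y]
    simp only [margA, Fin.sum_univ_two, re, ← Complex.add_re, ← Complex.sub_re,
      ← Matrix.trace_add, ← Matrix.trace_sub, ← Matrix.add_mul, ← Matrix.sub_mul]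
    congr 3
    ext
    simp
    ring
  · rw [hB, ← sE x]
    simp only [margB, Fin.sum_univ_two, re, ← Complex.add_re, ← Complex.sub_re,
      ← Matrix.trace_add, ← Matrix.trace_sub, ← Matrix.add_mul, ← Matrix.sub_mul]
    congr 3
    ext
    simp
    ring
  · simp only [hC, kronecker, ← mul_kronecker_mul, mul_one, one_mul]
    simp only [corr, Fin.sum_univ_two, zero_ne_one, one_ne_zero, if_true, if_false, re,
      ← Complex.neg_re, ← Matrix.trace_neg, ← Matrix.neg_mul, ← Complex.add_re,
      ← Matrix.trace_add, ← Matrix.add_mul]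
    congr 3
    ext
    simp
    ring
  · have h : (1 : ℝ) = ((kronecker (E x 0 + E x 1) (F y 0 + F y 1) * ρ).trace).re := by
      rw [sE, sF, ← h1, one_mul, hρ.2, Complex.one_re]
    rw [h]
    simp only [Fin.sum_univ_two, re, ← Complex.add_re, ← Matrix.trace_add, ← Matrix.add_mul]
    congr 3
    ext
    simp
    ring

end Finite

/-! ### Passing to the closure -/

section Closure

@[fun_prop]
theorem continuous_margA (x y : Fin 2) : Continuous fun P => margA P x y := by
  unfold margA
  fun_prop

@[fun_prop]
theorem continuous_margB (x y : Fin 2) : Continuous fun P => margB P x y := by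
  unfold margB
  fun_prop

@[fun_prop]
theorem continuous_corr (x y : Fin 2) : Continuous fun P => corr P x y := by
  simp only [corr, Fin.sum_univ_two, zero_ne_one, one_ne_zero, if_true, if_false]
  fun_prop

/-- A continuous function of the behaviour which vanishes at `pointNE` and controls the marginals. -/
noncomputable def defect (P : Behaviour 2 2) : ℝ :=
  √(2 + 2 * corr P 1 1) +
    √(3 - 2 * (corr P 0 0 + corr P 0 1 + corr P 1 0) + 2 * √(2 + 2 * corr P 1 1))

theorem continuous_defect : Continuous defect := by
  unfold defect
  fun_prop

theorem le_on_quantumSet {f g : Behaviour 2 2 → ℝ} (hf : Continuous f) (hg : Continuous g)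
    (h : ∀ P, IsModelled P → f P ≤ g P) {P : Behaviour 2 2} (hP : P ∈ quantumSet 2 2) :
    f P ≤ g P :=
  closure_minimal (fun _ hQ => h _ (isModelled_of_mem_quantumFinite hQ).1)
    (isClosed_le hf hg) hP

theorem sum_eq_one_of_mem_quantumSet {P : Behaviour 2 2} (hP : P ∈ quantumSet 2 2)
    (x y : Fin 2) : ∑ a, ∑ b, P x y a b = 1 :=
  closure_minimal (fun _ hQ => (isModelled_of_mem_quantumFinite hQ).2 x y)
    (isClosed_eq (f := fun P : Behaviour 2 2 => ∑ a, ∑ b, P x y a b) (g := fun _ => (1 : ℝ))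
      (by fun_prop) continuous_const) hP

theorem abs_corr_le_one {P : Behaviour 2 2} (hP : P ∈ quantumSet 2 2)
    (x y : Fin 2) : |corr P x y| ≤ 1 := by
  refine le_on_quantumSet (continuous_corr x y).abs continuous_const ?_ hP
  rintro P ⟨H, _, _, M, -, -, h⟩
  rw [h]
  exact M.abs_inner_le_one x y

theorem chained_corr_le {P : Behaviour 2 2} (hP : P ∈ quantumSet 2 2)
    {s : ℝ} (hs : 1 ≤ s) :
    (s ^ 2 - 1) * (corr P 0 0 + corr P 0 1 + corr P 1 0) - corr P 1 1 ≤ s ^ 3 := by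
  refine le_on_quantumSet (f := fun P => (s ^ 2 - 1) * (corr P 0 0 + corr P 0 1 + corr P 1 0) -
    corr P 1 1) (by fun_prop) continuous_const ?_ hP
  rintro P ⟨H, _, _, M, -, -, h⟩
  have := chained_inner_le (M.norm_A_ψ_le 1) (M.norm_B_ψ_le 0) (M.norm_A_ψ_le 0)
    (M.norm_B_ψ_le 1) hs
  rw [real_inner_comm (M.A 0 M.ψ) (M.B 0 M.ψ)] at this
  simp only [h]
  linarith

/-- At ⟨A₁B₁⟩ = -1 this makes a quadratic form in p, q, r nonnegative; its zeros will pin down the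
correlators. -/
theorem quadratic_corr_le {P : Behaviour 2 2} (hP : P ∈ quantumSet 2 2)
    (p q r : ℝ) :
    2 * p * q * corr P 0 0 + 2 * p * r * corr P 0 1 + 2 * q * r * corr P 1 0 ≤
      p ^ 2 + q ^ 2 + r ^ 2 + 2 * |q * r| * √(2 + 2 * corr P 1 1) := by
  refine le_on_quantumSet
    (f := fun P => 2 * p * q * corr P 0 0 + 2 * p * r * corr P 0 1 + 2 * q * r * corr P 1 0)
    (g := fun P => p ^ 2 + q ^ 2 + r ^ 2 + 2 * |q * r| * √(2 + 2 * corr P 1 1))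
    (by fun_prop) (by fun_prop) ?_ hP
  rintro P ⟨H, _, _, M, -, -, h⟩
  have key := two_mul_inner_add_le (u := M.A 0 M.ψ) (e := M.B 1 M.ψ) (w := M.A 1 M.ψ)
    (M.norm_B_ψ_le 0) p q r
  have hr : ‖M.A 1 M.ψ + M.B 1 M.ψ‖ ≤ √(2 + 2 * corr P 1 1) :=
    Real.le_sqrt_of_sq_le (h 1 1 ▸ M.norm_A_one_add_B_one_sq_le)
  have sq (t : ℝ) (w : H) (hw : ‖w‖ ≤ 1) : 0 ≤ t ^ 2 * (1 - ‖w‖ ^ 2) :=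
    mul_nonneg (sq_nonneg _) (sub_nonneg.2 (pow_le_one₀ (norm_nonneg _) hw))
  have := sq p _ (M.norm_A_ψ_le 0)
  have := sq q _ (M.norm_B_ψ_le 0)
  have := sq r _ (M.norm_B_ψ_le 1)
  have := sq_nonneg ‖p • M.A 0 M.ψ - q • M.B 0 M.ψ - r • M.B 1 M.ψ‖
  have := mul_le_mul_of_nonneg_left hr (mul_nonneg zero_le_two (abs_nonneg (q * r)))
  simp only [h] at *
  linarith

theorem abs_margA_le_defect {P : Behaviour 2 2} (hP : P ∈ quantumSet 2 2)
    (x y : Fin 2) : |margA P x y| ≤ 25 * defect P := by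
  refine le_on_quantumSet (f := fun P => |margA P x y|) (g := fun P => 25 * defect P)
    (continuous_margA x y).abs (continuous_const.mul continuous_defect) ?_ hP
  rintro P ⟨H, _, _, M, h, -, hc⟩
  obtain ⟨h₀, h₁, hA, hB⟩ := M.exists_defect_le (hc 0 0).symm (hc 0 1).symm (hc 1 0).symm
    (hc 1 1).symm (η := defect P) rfl
  simpa only [h] using M.abs_expectation_A_le h₀ h₁ hA hB x

theorem abs_margB_le_defect {P : Behaviour 2 2} (hP : P ∈ quantumSet 2 2)
    (x y : Fin 2) : |margB P x y| ≤ 12 * defect P := by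
  refine le_on_quantumSet (f := fun P => |margB P x y|) (g := fun P => 12 * defect P)
    (continuous_margB x y).abs (continuous_const.mul continuous_defect) ?_ hP
  rintro P ⟨H, _, _, M, -, h, hc⟩
  obtain ⟨h₀, h₁, hA, hB⟩ := M.exists_defect_le (hc 0 0).symm (hc 0 1).symm (hc 1 0).symm
    (hc 1 1).symm (η := defect P) rfl
  simpa only [h] using M.abs_expectation_B_le h₀ h₁ hA hB y

end Closure

theorem margA_ofTable (A B : Fin 2 → ℝ) (C : Fin 2 → Fin 2 → ℝ) (x y : Fin 2) :
    margA (ofTable A B C) x y = A x := by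
  simp [margA, ofTable, Fin.sum_univ_two]; ring

theorem margB_ofTable (A B : Fin 2 → ℝ) (C : Fin 2 → Fin 2 → ℝ) (x y : Fin 2) :
    margB (ofTable A B C) x y = B y := by
  simp [margB, ofTable, Fin.sum_univ_two]; ring

theorem corr_ofTable (A B : Fin 2 → ℝ) (C : Fin 2 → Fin 2 → ℝ) (x y : Fin 2) :
    corr (ofTable A B C) x y = C x y := by
  simp [corr, ofTable, Fin.sum_univ_two]; ring

theorem eq_ofTable {P : Behaviour 2 2} {A B : Fin 2 → ℝ} {C : Fin 2 → Fin 2 → ℝ}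
    (hs : ∀ x y, ∑ a, ∑ b, P x y a b = 1) (hA : ∀ x y, margA P x y = A x)
    (hB : ∀ x y, margB P x y = B y) (hC : ∀ x y, corr P x y = C x y) : P = ofTable A B C := by
  funext x y a b
  have h1 := hs x y
  have h2 := hA x y
  have h3 := hB x y
  have h4 := hC x y
  simp only [margA, margB, corr, Fin.sum_univ_two, zero_ne_one, one_ne_zero, if_true,
    if_false] at h1 h2 h3 h4
  fin_cases a <;> fin_cases b <;> simp [ofTable] <;> linarith

/-- `pointNE` maximises the sum of the other correlators when `⟨A_1 B_1⟩ = -1`, uniquely so. -/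
theorem eq_pointNE {P : Behaviour 2 2} (hP : P ∈ quantumSet 2 2) (h11 : corr P 1 1 = -1)
    (hsum : corr P 0 0 + corr P 0 1 + corr P 1 0 = 3 / 2) : P = pointNE := by
  have hd : defect P = 0 := by
    unfold defect
    rw [h11, hsum]
    norm_num
  have hA (x y) : margA P x y = 0 := by
    simpa [hd] using abs_margA_le_defect hP x y
  have hB (x y) : margB P x y = 0 := by
    simpa [hd] using abs_margB_le_defect hP x y
  have q (p q r : ℝ) := quadratic_corr_le hP p q r
  simp only [h11, mul_neg, mul_one, add_neg_cancel, Real.sqrt_zero, mul_zero, add_zero] at q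
  have sq_zero {t : ℝ} (ht : t ^ 2 ≤ 0) : t = 0 := pow_eq_zero_iff two_ne_zero |>.1
    (le_antisymm ht (sq_nonneg t))
  -- The quadratic form vanishes at (1, 1, 1), so its gradient does too. A shift of one coordinate
  -- by the presumed defect t turns nonnegativity into -t² ≥ 0.
  have e1 : corr P 0 0 + corr P 0 1 - 1 = 0 := by
    have := q (1 + (corr P 0 0 + corr P 0 1 - 1)) 1 1
    exact sq_zero (by nlinarith)
  have e2 : corr P 0 0 + corr P 1 0 - 1 = 0 := by
    have := q 1 (1 + (corr P 0 0 + corr P 1 0 - 1)) 1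
    exact sq_zero (by nlinarith)
  refine eq_ofTable (sum_eq_one_of_mem_quantumSet hP) hA hB fun x y => ?_
  fin_cases x <;> fin_cases y <;> simp <;> linarith

theorem corr_sum_le {P : Behaviour 2 2} (hP : P ∈ quantumSet 2 2) (h11 : corr P 1 1 = -1) :
    corr P 0 0 + corr P 0 1 + corr P 1 0 ≤ 3 / 2 := by
  have := quadratic_corr_le hP 1 1 1
  simp only [h11, mul_neg, mul_one, add_neg_cancel, Real.sqrt_zero, mul_zero, add_zero] at this
  linarith

/-! ### Qubit realisations -/

section Construction

open Matrix

/-- The qubit effect `(1 + z σ_z + x σ_x) / 2`. -/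
noncomputable def qubitEffect (z x : ℝ) : Matrix (Fin 2) (Fin 2) ℂ :=
  !![((1 + z) / 2 : ℝ), (x / 2 : ℝ); (x / 2 : ℝ), ((1 - z) / 2 : ℝ)]

theorem posSemidef_qubitEffect {z x : ℝ} (h : z ^ 2 + x ^ 2 ≤ 1) :
    (qubitEffect z x).PosSemidef := by
  have hH : (qubitEffect z x).IsHermitian := by
    ext i j
    fin_cases i <;> fin_cases j <;> simp [qubitEffect]
  have e : qubitEffect z x = qubitEffect z x * (qubitEffect z x)ᴴ +
      ((1 - (z ^ 2 + x ^ 2)) / 4) • (1 : Matrix (Fin 2) (Fin 2) ℂ) := by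
    rw [hH.eq]
    ext i j
    fin_cases i <;> fin_cases j <;> simp [qubitEffect] <;> ring
  rw [e]
  exact (posSemidef_self_mul_conjTranspose _).add (PosSemidef.one.smul (by linarith))

/-- The measurement along the vector `u` of the unit disc. -/
noncomputable def discMeasurement (u : ℝ × ℝ) : Fin 2 → Matrix (Fin 2) (Fin 2) ℂ :=
  ![qubitEffect u.1 u.2, qubitEffect (-u.1) (-u.2)]

theorem isMeasurement_discMeasurement {u : ℝ × ℝ} (hu : u.1 ^ 2 + u.2 ^ 2 ≤ 1) :
    IsMeasurement (discMeasurement u) := by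
  refine ⟨fun a => ?_, ?_⟩
  · fin_cases a
    · exact posSemidef_qubitEffect hu
    · exact posSemidef_qubitEffect (by simpa using hu)
  · ext i j
    fin_cases i <;> fin_cases j <;> simp [discMeasurement, qubitEffect, Fin.sum_univ_two] <;> ring

/-- The maximally entangled state of two qubits. -/
noncomputable def bellState : Matrix (Fin 2 × Fin 2) (Fin 2 × Fin 2) ℂ :=
  (1 / 2 : ℝ) • vecMulVec (fun i => if i.1 = i.2 then 1 else 0)
    (star fun i => if i.1 = i.2 then 1 else 0)

theorem isState_bellState : IsState bellState := by
  refine ⟨(posSemidef_vecMulVec_self_star _).smul (by norm_num), ?_⟩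
  simp [bellState, Matrix.trace, vecMulVec_apply, Fintype.sum_prod_type]

/-- Inner products of vectors of the unit disc are quantum correlators with unbiased marginals. -/
theorem ofTable_mem_quantumSet (u v : Fin 2 → ℝ × ℝ) (hu : ∀ x, (u x).1 ^ 2 + (u x).2 ^ 2 ≤ 1)
    (hv : ∀ y, (v y).1 ^ 2 + (v y).2 ^ 2 ≤ 1) :
    ofTable (fun _ => 0) (fun _ => 0) (fun x y => (u x).1 * (v y).1 + (u x).2 * (v y).2) ∈
      quantumSet 2 2 := by
  refine subset_closure ⟨2, bellState, fun x => discMeasurement (u x),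
    fun y => discMeasurement (v y), isState_bellState,
    fun x => isMeasurement_discMeasurement (hu x),
    fun y => isMeasurement_discMeasurement (hv y), fun x y a b => ?_⟩
  fin_cases a <;> fin_cases b <;>
    simp [ofTable, discMeasurement, qubitEffect, bellState, Matrix.trace, Matrix.mul_apply,
      vecMulVec_apply, Fintype.sum_prod_type, Fin.sum_univ_two] <;> ring

end Construction

/-- The point of the slice with coordinates `α` and `⟨A_1 B_1⟩ = γ`. -/
noncomputable def slicePoint (α γ : ℝ) : Behaviour 2 2 :=
  ofTable (fun _ => 0) (fun _ => 0) ![![α, α], ![α, γ]]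

theorem inSlice_slicePoint (α γ : ℝ) : InSlice α (slicePoint α γ) := by
  simp [InSlice, slicePoint, margA_ofTable, margB_ofTable, corr_ofTable]

theorem corr_slicePoint (α γ : ℝ) : corr (slicePoint α γ) 1 1 = γ := by
  simp [slicePoint, corr_ofTable]

theorem slicePoint_mem_of_vectors {α γ : ℝ} {u₀ u₁ v₀ v₁ : ℝ × ℝ} (hu₀ : u₀.1 ^ 2 + u₀.2 ^ 2 ≤ 1)
    (hu₁ : u₁.1 ^ 2 + u₁.2 ^ 2 ≤ 1) (hv₀ : v₀.1 ^ 2 + v₀.2 ^ 2 ≤ 1)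
    (hv₁ : v₁.1 ^ 2 + v₁.2 ^ 2 ≤ 1) (h₀₀ : u₀.1 * v₀.1 + u₀.2 * v₀.2 = α)
    (h₀₁ : u₀.1 * v₁.1 + u₀.2 * v₁.2 = α) (h₁₀ : u₁.1 * v₀.1 + u₁.2 * v₀.2 = α)
    (h₁₁ : u₁.1 * v₁.1 + u₁.2 * v₁.2 = γ) : slicePoint α γ ∈ quantumSet 2 2 := by
  have h := ofTable_mem_quantumSet ![u₀, u₁] ![v₀, v₁] (by simp [Fin.forall_fin_two, *])
    (by simp [Fin.forall_fin_two, *])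
  convert h using 1
  unfold slicePoint
  congr 1
  funext x y
  fin_cases x <;> fin_cases y <;> simp [*]

theorem slicePoint_neg_one_mem {α : ℝ} (h₁ : -1 ≤ α) (h₂ : α ≤ 1 / 2) :
    slicePoint α (-1) ∈ quantumSet 2 2 := by
  -- The remaining condition is -α² + yy' = α with both vectors in the disc. It is solvable when |α
  -- + α²| ≤ 1 - α², which for α ≥ 0 means α ≤ 1/2.
  obtain ⟨y, y', hy, hy', hyy⟩ : ∃ y y' : ℝ, α ^ 2 + y ^ 2 ≤ 1 ∧ α ^ 2 + y' ^ 2 ≤ 1 ∧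
      y * y' = α + α ^ 2 := by
    rcases le_total 0 α with h | h
    · have hs := Real.sq_sqrt (by positivity : 0 ≤ α + α ^ 2)
      exact ⟨√(α + α ^ 2), √(α + α ^ 2), by nlinarith, by nlinarith, by nlinarith⟩
    · have hs := Real.sq_sqrt (by nlinarith : 0 ≤ -(α + α ^ 2))
      exact ⟨√(-(α + α ^ 2)), -√(-(α + α ^ 2)), by nlinarith, by nlinarith, by nlinarith⟩
  exact slicePoint_mem_of_vectors (u₀ := (α, y)) (u₁ := (-1, 0)) (v₀ := (-α, y')) (v₁ := (1, 0))
    hy (by simp) (by simpa using hy') (by simp) (by simp only; linarith) (by simp) (by simp)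
    (by simp)

theorem slicePoint_curve_mem {α : ℝ} (h₁ : -1 ≤ α) (h₂ : α ≤ 1) :
    slicePoint α (-(3 * α - 4 * α ^ 3)) ∈ quantumSet 2 2 := by
  have hs := Real.sq_sqrt (by nlinarith : 0 ≤ 1 - α ^ 2)
  set s := √(1 - α ^ 2)
  -- With α = cos θ, the directions A₁, B₀, A₀, B₁ have angles 0, θ, 2θ, 3θ.
  refine slicePoint_mem_of_vectors (u₁ := (1, 0)) (v₀ := (α, s)) (u₀ := (2 * α ^ 2 - 1, 2 * α * s))
    (v₁ := (4 * α ^ 3 - 3 * α, (4 * α ^ 2 - 1) * s)) (le_of_eq ?_) (by simp) (by simp [hs])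
    (le_of_eq ?_) ?_ ?_ (by simp) (by simp) <;> simp only
  · linear_combination (4 * α ^ 2) * hs
  · linear_combination ((4 * α ^ 2 - 1) ^ 2) * hs
  · linear_combination (2 * α) * hs
  · linear_combination (2 * α * (4 * α ^ 2 - 1)) * hs

theorem slicePoint_sliceBound_mem {α : ℝ} (h₁ : -1 ≤ α) (h₂ : α ≤ 1) :
    slicePoint α (-sliceBound α) ∈ quantumSet 2 2 := by
  unfold sliceBound
  split_ifs with h
  · exact slicePoint_neg_one_mem h₁ h.le
  · exact slicePoint_curve_mem h₁ h₂

theorem pointNE_eq_slicePoint : pointNE = slicePoint (1 / 2) (-1) := rfl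

theorem pointNE_mem_quantumSet : pointNE ∈ quantumSet 2 2 :=
  slicePoint_neg_one_mem (by norm_num) le_rfl

/-! ### The boundary curve, extremality and non-exposedness -/

theorem neg_corr_le_sliceBound {α : ℝ} {P : Behaviour 2 2} (hP : P ∈ quantumSet 2 2)
    (h : InSlice α P) : -corr P 1 1 ≤ sliceBound α := by
  obtain ⟨-, -, h₀₀, h₀₁, h₁₀⟩ := h
  unfold sliceBound
  split_ifs with hα
  · linarith [(abs_le.1 (abs_corr_le_one hP 1 1)).1]
  · have := chained_corr_le hP (s := 2 * α) (by linarith)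
    rw [h₀₀, h₀₁, h₁₀] at this
    linarith

theorem hasDerivWithinAt_sliceBound_left :
    HasDerivWithinAt sliceBound 0 (Set.Iic (1 / 2)) (1 / 2) := by
  refine (hasDerivWithinAt_const (1 / 2 : ℝ) (Set.Iic (1 / 2)) (1 : ℝ)).congr (fun x hx => ?_) ?_
  · rcases (Set.mem_Iic.1 hx).lt_or_eq with h | h
    · rw [sliceBound, if_pos h]
    · rw [sliceBound, if_neg h.not_lt, h]
      norm_num
  · norm_num [sliceBound]

theorem hasDerivWithinAt_sliceBound_right :
    HasDerivWithinAt sliceBound 0 (Set.Ici (1 / 2)) (1 / 2) := by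
  have h : HasDerivAt (fun x : ℝ => 3 * x - 4 * x ^ 3) 0 (1 / 2) := by
    refine (((hasDerivAt_id (1 / 2 : ℝ)).const_mul 3).sub
      ((hasDerivAt_pow 3 (1 / 2 : ℝ)).const_mul 4)).congr_deriv ?_
    norm_num
  refine h.hasDerivWithinAt.congr (fun x hx => ?_) ?_
  · rw [sliceBound, if_neg (not_lt.2 hx)]
  · norm_num [sliceBound]

theorem corr_combo (s t : ℝ) (P Q : Behaviour 2 2) (x y : Fin 2) :
    corr (s • P + t • Q) x y = s * corr P x y + t * corr Q x y := by
  simp [corr, Fin.sum_univ_two]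
  ring

/-- Both endpoints of a segment through P_NE inherit each maximum in turn: first -⟨A₁B₁⟩ = 1, then
the correlator sum 3/2. -/
theorem pointNE_mem_extremePoints : pointNE ∈ (quantumSet 2 2).extremePoints ℝ := by
  refine mem_extremePoints_iff_left.2 ⟨pointNE_mem_quantumSet, fun P hP Q hQ h => ?_⟩
  obtain ⟨s, t, hs, ht, hst, h⟩ := h
  have hc (x y) : s * corr P x y + t * corr Q x y = corr pointNE x y := by
    rw [← corr_combo, h]
  have hNE : corr pointNE 1 1 = -1 := corr_slicePoint _ _
  obtain ⟨-, -, h₀₀, h₀₁, h₁₀⟩ := inSlice_slicePoint (1 / 2) (-1)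
  rw [← pointNE_eq_slicePoint] at h₀₀ h₀₁ h₁₀
  have extremal {a b m : ℝ} (ha : a ≤ m) (hb : b ≤ m) (hab : s * a + t * b = m) :
      a = m ∧ b = m := by
    have h1 := mul_nonneg hs.le (sub_nonneg.2 ha)
    have h2 := mul_nonneg ht.le (sub_nonneg.2 hb)
    have h3 : s * (m - a) + t * (m - b) = 0 := by linear_combination m * hst - hab
    constructor
    · have : s * (m - a) = 0 := by linarith
      linarith [(mul_eq_zero.1 this).resolve_left hs.ne']
    · have : t * (m - b) = 0 := by linarith
      linarith [(mul_eq_zero.1 this).resolve_left ht.ne']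
  have c₁₁ := hc 1 1
  have e := extremal (a := -corr P 1 1) (b := -corr Q 1 1) (m := 1)
    (by linarith [(abs_le.1 (abs_corr_le_one hP 1 1)).1])
    (by linarith [(abs_le.1 (abs_corr_le_one hQ 1 1)).1]) (by linarith)
  have eP : corr P 1 1 = -1 := by linarith [e.1]
  have eQ : corr Q 1 1 = -1 := by linarith [e.2]
  have e' := extremal (corr_sum_le hP eP) (corr_sum_le hQ eQ) (by linarith [hc 0 0, hc 0 1, hc 1 0])
  exact eq_pointNE hP eP e'.1

theorem slicePoint_eq_combo (α γ : ℝ) :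
    slicePoint α γ = slicePoint 0 0 + α • (slicePoint 1 0 - slicePoint 0 0) +
      γ • (slicePoint 0 1 - slicePoint 0 0) := by
  funext x y a b
  simp only [slicePoint, ofTable, Pi.add_apply, Pi.smul_apply, Pi.sub_apply, smul_eq_mul]
  fin_cases x <;> fin_cases y <;> simp <;> ring

theorem pointNE_notMem_exposedPoints_quantumSlice : pointNE ∉ quantumSlice.exposedPoints ℝ := by
  rintro ⟨-, l, hl⟩
  set p := l (slicePoint 1 0 - slicePoint 0 0)
  set q := l (slicePoint 0 1 - slicePoint 0 0)
  have hlin (α γ : ℝ) : l (slicePoint α γ) = l (slicePoint 0 0) + α * p + γ * q := by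
    rw [slicePoint_eq_combo]
    simp [p, q]
  rw [pointNE_eq_slicePoint] at hl
  have hflat := hl _ ⟨slicePoint_neg_one_mem le_rfl (by norm_num), _, inSlice_slicePoint (-1) (-1)⟩
  -- At α = 1/2 + h the curve has ⟨A₁B₁⟩ = -1 + 6h² + 4h³, with no linear term.
  have hcurve {h : ℝ} (h0 : 0 < h) (h1 : h ≤ 1 / 2) : p * h + q * (6 * h ^ 2 + 4 * h ^ 3) ≤ 0 := by
    have := (hl _ ⟨slicePoint_curve_mem (α := 1 / 2 + h) (by linarith) (by linarith), _,
      inSlice_slicePoint _ _⟩).1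
    rw [hlin (1 / 2 + h), hlin (1 / 2)] at this
    nlinarith
  rw [hlin (-1), hlin (1 / 2)] at hflat
  have hp : p ≤ 0 := by
    by_contra! hp
    -- The first bound gives 6h + 4h² ≤ 8h, the second 8h|q| ≤ p/2, so the linear term p wins.
    set h := min (1 / 2) (p / (16 * (|q| + 1)))
    have hq := abs_nonneg q
    have h0 : 0 < h := by positivity
    have h1 : h ≤ 1 / 2 := min_le_left _ _
    have h2 : h * (16 * (|q| + 1)) ≤ p :=
      (le_div_iff₀ (by positivity)).1 (min_le_right _ _)
    have h3 := hcurve h0 h1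
    have h4 : p + q * (6 * h + 4 * h ^ 2) ≤ 0 := by
      by_contra! h4
      have := mul_pos h0 h4
      nlinarith
    have h5 : -|q| * (8 * h) ≤ q * (6 * h + 4 * h ^ 2) := by
      have a1 : 6 * h + 4 * h ^ 2 ≤ 8 * h := by nlinarith
      have a2 : 0 ≤ 6 * h + 4 * h ^ 2 := by positivity
      nlinarith [neg_abs_le q]
    nlinarith
  -- As p ≤ 0, the point with α = -1 attains at least the value at P_NE, against uniqueness.
  have := hflat.2 (by linarith)
  have := congrArg (fun P => corr P 0 0) this
  simp only [(inSlice_slicePoint _ _).2.2.1] at this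
  norm_num at this

theorem pointNE_mem_quantumSlice : pointNE ∈ quantumSlice :=
  ⟨pointNE_mem_quantumSet, 1 / 2, inSlice_slicePoint _ _⟩

theorem mainTheorem3 :
    -- every quantum point of the slice has `α ∈ [-1, 1]`
    (∀ (α : ℝ) (P : Behaviour 2 2), P ∈ quantumSet 2 2 → InSlice α P → α ∈ Set.Icc (-1) 1) ∧
    -- tight upper bound on `-⟨A_1 B_1⟩` as a function of `α`
    (∀ α ∈ Set.Icc (-1 : ℝ) 1,
      IsGreatest {t : ℝ | ∃ P ∈ quantumSet 2 2, InSlice α P ∧ t = -corr P 1 1}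
        (sliceBound α)) ∧
    -- the flat and the curved part meet at `α = 1/2` with the same slope
    HasDerivWithinAt sliceBound 0 (Set.Iic (1 / 2)) (1 / 2) ∧
    HasDerivWithinAt sliceBound 0 (Set.Ici (1 / 2)) (1 / 2) ∧
    -- `P_NE` is the boundary point at `α = 1/2`
    InSlice (1 / 2) pointNE ∧ -corr pointNE 1 1 = sliceBound (1 / 2) ∧
    -- it is extremal but not exposed, and not even exposed in the slice
    pointNE ∈ (quantumSet 2 2).extremePoints ℝ ∧
    pointNE ∉ quantumSlice.exposedPoints ℝ ∧
    pointNE ∉ (quantumSet 2 2).exposedPoints ℝ := by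
  refine ⟨fun α P hP h => ?_, fun α hα => ⟨?_, ?_⟩, hasDerivWithinAt_sliceBound_left,
    hasDerivWithinAt_sliceBound_right, inSlice_slicePoint _ _, ?_, pointNE_mem_extremePoints,
    pointNE_notMem_exposedPoints_quantumSlice, fun h => ?_⟩
  · exact h.2.2.1 ▸ abs_le.1 (abs_corr_le_one hP 0 0)
  · exact ⟨_, slicePoint_sliceBound_mem hα.1 hα.2, inSlice_slicePoint _ _,
      by rw [corr_slicePoint, neg_neg]⟩
  · rintro t ⟨P, hP, h, rfl⟩
    exact neg_corr_le_sliceBound hP h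
  · rw [pointNE_eq_slicePoint, corr_slicePoint]
    norm_num [sliceBound]
  · obtain ⟨-, l, hl⟩ := h
    exact pointNE_notMem_exposedPoints_quantumSlice
      ⟨pointNE_mem_quantumSlice, l, fun y hy => hl y hy.1⟩
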